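/- Let $V$ be a real vector space of dimension $3$. Let $W\subset (V^*)^{\otimes 4}$ be the space of all $S\in \mathrm{Sym}^2(\mathrm{Sym}^2V^*)\oplus \mathrm{Sym}^2(\Lambda^2V^*)$ with $S(v_1,v_2,v_3,v_4)=S(v_1,v_4,v_3,v_2)$ for all $v_i\in V$. Regard each $S\in W$ as a symmetric bilinear form on $V\otimes V$, let $\mathcal C_W=\{S\in W: S\ge 0\}$ be the cone of positive semi-definite elements, and let $\mathcal C_W^*=\{M\in W^*: M(S)\ge 0\ \ \forall S\in\mathcal C_W\}$ be its dual cone. Write $\alpha\vee\beta=\frac12(\alpha\otimes\beta+\beta\otimes\alpha)$, $\alpha\wedge\beta=\frac12(\alpha\otimes\beta-\beta\otimes\alpha)$ (for vectors or one-forms), and $\beta_1\beta_2\cdots\beta_k=\frac1{k!}\sum_{\sigma\in S_k}\beta_{\sigma(1)}\otimes\cdots\otimes\beta_{\sigma(k)}$. Say that $M\in W^*$ satisfies the *elastic positivity bounds* if $M(\alpha^4)\ge 0$ for all $\alpha\in V^*\setminus\{0\}$ and $M\big((\alpha_1\vee\alpha_2)^{\otimes2}+(\alpha_1\wedge\alpha_2)^{\otimes2}\big)\ge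 0$ for all linearly independent $\alpha_1,\alpha_2\in V^*$. Say that $M$ satisfies the *inelastic positivity bounds* if $M(S)\ge 0$ for every basis $\alpha_1,\alpha_2,\alpha_3$ of $V^*$ and all $d,g,h\in\mathbb R$ with $g^2>1-d^2+dh$, where $$\begin{aligned}S=\;&\alpha_1^4+6\alpha_1^2\alpha_2^2+6\alpha_1^2\alpha_3^2+12d\,\alpha_1\alpha_2^2\alpha_3+12g\,\alpha_1\alpha_2\alpha_3^2+4h\,\alpha_1\alpha_3^3+(1+d^2)\alpha_2^4+4dg\,\alpha_2^3\alpha_3\\&+6(1+dh)\alpha_2^2\alpha_3^2+4g(d+h)\alpha_2\alpha_3^3+(1+g^2+h^2)\alpha_3^4\\&+2(g^2+d^2-1-dh)\big[(\alpha_2\otimes\alpha_3)^{\otimes2}+(\alpha_3\otimes\alpha_2)^{\otimes2}\big].\end{aligned}$$ Fix a basis $e_1,e_2,e_3$ of $V$, identify $V\cong\mathbb R^3$, and let $\mathrm O(3)$ act on $V$ and, by the induced action, on $W^*$. Every tensor in $V^{\otimes4}$ defines an element of $W^*$ by the natural pairing. For $a_1,a_2\in\mathbb R$ let $M_{a_1,a_2}\in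 W^*$ be the element defined by $$a_1(e_1^2+e_2^2+e_3^2)^{\otimes2}+a_2\Big(\sum_i e_i^4+2\sum_{i<j}(e_i\vee e_j)^{\otimes2}\Big)+(2a_2-4a_1)\sum_{i<j}(e_i\wedge e_j)^{\otimes2}.$$ **Theorem.** 1. Each $M_{a_1,a_2}$ is $\mathrm O(3)$-invariant, and every $M\in(W^*)^{\mathrm O(3)}$ equals $M_{a_1,a_2}$ for exactly one pair $(a_1,a_2)\in\mathbb R^2$. 2. Let $M\in(W^*)^{\mathrm O(3)}$. Then $M\in\mathcal C_W^*$ if and only if $M$ satisfies the elastic positivity bounds. 3. $M_{a_1,a_2}$ satisfies the elastic positivity bounds if and only if $a_2\ge|a_1|$. 4. If $M\in(W^*)^{\mathrm O(3)}$ satisfies the elastic positivity bounds, then it satisfies the inelastic positivity bounds. 5. (Pions.) For $\ell_1,\ell_2\in\mathbb R$ let $M\in W^*$ be the element defined by $$(2\ell_1+3\ell_2)\Big(\sum_i e_i^4+2\sum_{i<j}(e_i\vee e_j)^{\otimes2}\Big)+(2\ell_1+\ell_2)(e_1^2+e_2^2+e_3^2)^{\otimes2}+2(\ell_2-2\ell_1)\sum_{i<j}(e_i\wedge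 e_j)^{\otimes2},$$ the four-tensor of forward two-to-two pion scattering in chiral perturbation theory. Then $M$ is $\mathrm O(3)$-invariant, its elastic positivity bounds are equivalent to $\ell_2\ge-\ell_1$ and $\ell_2\ge0$, and these bounds are optimal: $M\in\mathcal C_W^*$ if and only if $\ell_2\ge-\ell_1$ and $\ell_2\ge 0$. -/

import Mathlib

open scoped TensorProduct

noncomputable section

namespace FlavorCone

section General

variable {V : Type*} [AddCommGroup V] [Module ℝ V]

/-- Covariant four-tensors on `V`, seen as bilinear forms on `V ⊗ V`:
`S(v₁,v₂,v₃,v₄) = S (v₁ ⊗ v₂) (v₃ ⊗ v₄)`. -/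
abbrev FourTensor (V : Type*) [AddCommGroup V] [Module ℝ V] : Type _ :=
  LinearMap.BilinForm ℝ (V ⊗[ℝ] V)

/-- `Sym²(Sym² V*)`: symmetric forms on `V ⊗ V` that are symmetric inside each pair of arguments. -/
def symSym (V : Type*) [AddCommGroup V] [Module ℝ V] : Submodule ℝ (FourTensor V) where
  carrier := {S | (∀ p q, S p q = S q p) ∧ ∀ v w q, S (v ⊗ₜ[ℝ] w) q = S (w ⊗ₜ[ℝ] v) q}
  add_mem' := by
    rintro S T ⟨h1, h2⟩ ⟨h3, h4⟩
    exact ⟨fun p q => by simp [h1 p q, h3 p q], fun v w q => by simp [h2 v w q, h4 v w q]⟩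
  zero_mem' := by simp
  smul_mem' := by
    rintro c S ⟨h1, h2⟩
    exact ⟨fun p q => by simp [h1 p q], fun v w q => by simp [h2 v w q]⟩

/-- `Sym²(Λ² V*)`: symmetric forms on `V ⊗ V` that are antisymmetric inside each pair of
arguments. -/
def symAlt (V : Type*) [AddCommGroup V] [Module ℝ V] : Submodule ℝ (FourTensor V) where
  carrier := {S | (∀ p q, S p q = S q p) ∧ ∀ v w q, S (v ⊗ₜ[ℝ] w) q = -S (w ⊗ₜ[ℝ] v) q}
  add_mem' := by
    rintro S T ⟨h1, h2⟩ ⟨h3, h4⟩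
    exact ⟨fun p q => by simp [h1 p q, h3 p q],
      fun v w q => by simp only [LinearMap.add_apply, h2 v w q, h4 v w q]; ring⟩
  zero_mem' := by simp
  smul_mem' := by
    rintro c S ⟨h1, h2⟩
    exact ⟨fun p q => by simp [h1 p q], fun v w q => by simp [h2 v w q]⟩

/-- The tensors with `τ S = S`, where `(τ S)(v₁,v₂,v₃,v₄) = S(v₁,v₄,v₃,v₂)`. -/
def tauInvariant (V : Type*) [AddCommGroup V] [Module ℝ V] : Submodule ℝ (FourTensor V) where
  carrier := {S | ∀ v₁ v₂ v₃ v₄ : V,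
    S (v₁ ⊗ₜ[ℝ] v₄) (v₃ ⊗ₜ[ℝ] v₂) = S (v₁ ⊗ₜ[ℝ] v₂) (v₃ ⊗ₜ[ℝ] v₄)}
  add_mem' := by
    intro S T h1 h2 v₁ v₂ v₃ v₄
    simp [h1 v₁ v₂ v₃ v₄, h2 v₁ v₂ v₃ v₄]
  zero_mem' := by simp
  smul_mem' := by
    intro c S h1 v₁ v₂ v₃ v₄
    simp [h1 v₁ v₂ v₃ v₄]

/-- `W = {S ∈ Sym²(Sym² V*) ⊕ Sym²(Λ² V*) : τ S = S}`. -/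
def W (V : Type*) [AddCommGroup V] [Module ℝ V] : Submodule ℝ (FourTensor V) :=
  (symSym V ⊔ symAlt V) ⊓ tauInvariant V

/-- Componentwise description of `W`: `S₁₂₃₄ = S₃₄₁₂ = S₂₁₄₃ = S₁₄₃₂`. -/
theorem mem_W_iff {S : FourTensor V} :
    S ∈ W V ↔ ∀ a b c d : V,
      S (a ⊗ₜ[ℝ] b) (c ⊗ₜ[ℝ] d) = S (c ⊗ₜ[ℝ] d) (a ⊗ₜ[ℝ] b) ∧
      S (a ⊗ₜ[ℝ] b) (c ⊗ₜ[ℝ] d) = S (b ⊗ₜ[ℝ] a) (d ⊗ₜ[ℝ] c) ∧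
      S (a ⊗ₜ[ℝ] d) (c ⊗ₜ[ℝ] b) = S (a ⊗ₜ[ℝ] b) (c ⊗ₜ[ℝ] d) := by
  constructor
  · rintro ⟨h, ht⟩ a b c d
    obtain ⟨A, hA, B, hB, rfl⟩ := Submodule.mem_sup.1 h
    refine ⟨?_, ?_, ht a b c d⟩
    · simp [hA.1 (a ⊗ₜ[ℝ] b), hB.1 (a ⊗ₜ[ℝ] b)]
    · simp only [LinearMap.add_apply]
      rw [hA.2 a b, hA.1, hA.2 c d, hA.1, hB.2 a b, hB.1, hB.2 c d, hB.1 (d ⊗ₜ[ℝ] c)]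
      ring
  · intro h
    have hs : ∀ p q, S p q = S q p := by
      have : S = S.flip := by
        ext a b c d
        simpa using (h a b c d).1
      intro p q
      exact LinearMap.congr_fun (LinearMap.congr_fun this p) q
    let σ : V ⊗[ℝ] V →ₗ[ℝ] V ⊗[ℝ] V := (TensorProduct.comm ℝ V V).toLinearMap
    have hσ : ∀ v w : V, σ (v ⊗ₜ[ℝ] w) = w ⊗ₜ[ℝ] v := fun v w => rfl
    have hσσ : ∀ p q, S (σ p) (σ q) = S p q := by
      have : S.compl₁₂ σ σ = S := by
        ext a b c d
        simpa [hσ] using (h a b c d).2.1.symm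
      intro p q
      exact LinearMap.congr_fun (LinearMap.congr_fun this p) q
    have hinv : ∀ p, σ (σ p) = p := fun p => by simp [σ]
    have hmove : ∀ p q, S (σ p) q = S p (σ q) := fun p q => by
      rw [← hσσ p (σ q), hinv]
    refine ⟨Submodule.mem_sup.2 ⟨(1 / 2 : ℝ) • (S + S ∘ₗ σ), ⟨?_, ?_⟩,
      (1 / 2 : ℝ) • (S - S ∘ₗ σ), ⟨?_, ?_⟩, ?_⟩, fun a b c d => (h a b c d).2.2⟩
    · intro p q
      simp [hs p q, hmove p q, hs p (σ q)]
    · intro v w q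
      simp [hσ, add_comm]
    · intro p q
      simp [hs p q, hmove p q, hs p (σ q)]
    · intro v w q
      simp [hσ]
      ring
    · ext a b c d
      simp
      ring

/-- The positivity cone `C_W`: the positive semi-definite elements of `W`. -/
def positivityCone (V : Type*) [AddCommGroup V] [Module ℝ V] : Set (W V) :=
  {S | (S : FourTensor V).IsPosSemidef}

/-- The dual cone `C_W* = {M ∈ W* : M(S) ≥ 0 for all S ∈ C_W}`. -/
def dualCone (V : Type*) [AddCommGroup V] [Module ℝ V] :
    PointedCone ℝ (Module.Dual ℝ (W V)) :=
  PointedCone.dual (Module.Dual.eval ℝ (W V)) (positivityCone V)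

/-- The bilinear form `α ⊗ β`, as a linear form on `V ⊗ V`. -/
def tens (α β : Module.Dual ℝ V) : Module.Dual ℝ (V ⊗[ℝ] V) :=
  TensorProduct.dualDistrib ℝ V V (α ⊗ₜ[ℝ] β)

@[simp] theorem tens_apply (α β : Module.Dual ℝ V) (v w : V) :
    tens α β (v ⊗ₜ[ℝ] w) = α v * β w := by
  simp [tens]

/-- `α ∨ β = (α ⊗ β + β ⊗ α) / 2`. -/
def vee (α β : Module.Dual ℝ V) : Module.Dual ℝ (V ⊗[ℝ] V) :=
  (1 / 2 : ℝ) • (tens α β + tens β α)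

/-- `α ∧ β = (α ⊗ β - β ⊗ α) / 2`. -/
def wedge (α β : Module.Dual ℝ V) : Module.Dual ℝ (V ⊗[ℝ] V) :=
  (1 / 2 : ℝ) • (tens α β - tens β α)

/-- The four-tensor `φ ⊗ ψ` for two-tensors `φ, ψ`. -/
def pair (φ ψ : Module.Dual ℝ (V ⊗[ℝ] V)) : FourTensor V := φ.smulRight ψ

@[simp] theorem pair_apply (φ ψ : Module.Dual ℝ (V ⊗[ℝ] V)) (p q : V ⊗[ℝ] V) :
    pair φ ψ p q = φ p * ψ q := by
  simp [pair]

/-- The totally symmetric product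
`β₁β₂β₃β₄ = (1/4!) ∑_σ β_σ(1) ⊗ β_σ(2) ⊗ β_σ(3) ⊗ β_σ(4)`, as an element of `V*^{⊗4}`. -/
def symProdTensor (β : Fin 4 → Module.Dual ℝ V) : FourTensor V :=
  (1 / 24 : ℝ) • ∑ σ : Equiv.Perm (Fin 4),
    pair (tens (β (σ 0)) (β (σ 1))) (tens (β (σ 2)) (β (σ 3)))

theorem symProdTensor_apply (β : Fin 4 → Module.Dual ℝ V) (v : Fin 4 → V) :
    symProdTensor β (v 0 ⊗ₜ[ℝ] v 1) (v 2 ⊗ₜ[ℝ] v 3) =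
      (1 / 24 : ℝ) * ∑ σ : Equiv.Perm (Fin 4), ∏ i, β (σ i) (v i) := by
  simp [symProdTensor, LinearMap.sum_apply, Fin.prod_univ_four, mul_assoc]

theorem symProdTensor_perm (β : Fin 4 → Module.Dual ℝ V) (v : Fin 4 → V)
    (ρ : Equiv.Perm (Fin 4)) :
    symProdTensor β (v (ρ 0) ⊗ₜ[ℝ] v (ρ 1)) (v (ρ 2) ⊗ₜ[ℝ] v (ρ 3)) =
      symProdTensor β (v 0 ⊗ₜ[ℝ] v 1) (v 2 ⊗ₜ[ℝ] v 3) := by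
  have h := symProdTensor_apply β (fun i => v (ρ i))
  rw [h, symProdTensor_apply]
  congr 1
  rw [← Equiv.sum_comp (Equiv.mulRight ρ)]
  refine Finset.sum_congr rfl fun σ _ => ?_
  exact Equiv.prod_comp ρ (fun i => β (σ i) (v i))

theorem symProdTensor_mem (β : Fin 4 → Module.Dual ℝ V) : symProdTensor β ∈ W V := by
  rw [mem_W_iff]
  intro a b c d
  refine ⟨?_, ?_, ?_⟩
  · have h := symProdTensor_perm β ![a, b, c, d] (Equiv.swap 0 2 * Equiv.swap 1 3)
    rw [show (Equiv.swap 0 2 * Equiv.swap 1 3 : Equiv.Perm (Fin 4)) 0 = 2 by decide,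
      show (Equiv.swap 0 2 * Equiv.swap 1 3 : Equiv.Perm (Fin 4)) 1 = 3 by decide,
      show (Equiv.swap 0 2 * Equiv.swap 1 3 : Equiv.Perm (Fin 4)) 2 = 0 by decide,
      show (Equiv.swap 0 2 * Equiv.swap 1 3 : Equiv.Perm (Fin 4)) 3 = 1 by decide] at h
    exact h.symm
  · have h := symProdTensor_perm β ![a, b, c, d] (Equiv.swap 0 1 * Equiv.swap 2 3)
    rw [show (Equiv.swap 0 1 * Equiv.swap 2 3 : Equiv.Perm (Fin 4)) 0 = 1 by decide,
      show (Equiv.swap 0 1 * Equiv.swap 2 3 : Equiv.Perm (Fin 4)) 1 = 0 by decide,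
      show (Equiv.swap 0 1 * Equiv.swap 2 3 : Equiv.Perm (Fin 4)) 2 = 3 by decide,
      show (Equiv.swap 0 1 * Equiv.swap 2 3 : Equiv.Perm (Fin 4)) 3 = 2 by decide] at h
    exact h.symm
  · have h := symProdTensor_perm β ![a, b, c, d] (Equiv.swap 1 3)
    rw [show (Equiv.swap 1 3 : Equiv.Perm (Fin 4)) 0 = 0 by decide,
      show (Equiv.swap 1 3 : Equiv.Perm (Fin 4)) 1 = 3 by decide,
      show (Equiv.swap 1 3 : Equiv.Perm (Fin 4)) 2 = 2 by decide,
      show (Equiv.swap 1 3 : Equiv.Perm (Fin 4)) 3 = 1 by decide] at h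
    exact h

/-- The totally symmetric product `β₁β₂β₃β₄` as an element of `W`. -/
def symProd (β₁ β₂ β₃ β₄ : Module.Dual ℝ V) : W V :=
  ⟨symProdTensor ![β₁, β₂, β₃, β₄], symProdTensor_mem _⟩

/-- `(α ∨ β)^{⊗2} + (α ∧ β)^{⊗2}`, as an element of `W`. -/
def veeWedge (α β : Module.Dual ℝ V) : W V :=
  ⟨pair (vee α β) (vee α β) + pair (wedge α β) (wedge α β), by
    rw [mem_W_iff]
    intro a b c d
    refine ⟨?_, ?_, ?_⟩ <;> simp [vee, wedge] <;> ring⟩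

/-- `(α ⊗ β)^{⊗2} + (β ⊗ α)^{⊗2}`, as an element of `W`. -/
def tensSq (α β : Module.Dual ℝ V) : W V :=
  ⟨pair (tens α β) (tens α β) + pair (tens β α) (tens β α), by
    rw [mem_W_iff]
    intro a b c d
    refine ⟨?_, ?_, ?_⟩ <;> simp <;> ring⟩

/-- The generators of the extremal rays of the third kind:
`S_tot + 2 (g² + d² - 1 - d h) [(α₂ ⊗ α₃)^{⊗2} + (α₃ ⊗ α₂)^{⊗2}]`. -/
def thirdKind (α₁ α₂ α₃ : Module.Dual ℝ V) (d g h : ℝ) : W V :=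
  symProd α₁ α₁ α₁ α₁
  + (6 : ℝ) • symProd α₁ α₁ α₂ α₂
  + (6 : ℝ) • symProd α₁ α₁ α₃ α₃
  + (12 * d) • symProd α₁ α₂ α₂ α₃
  + (12 * g) • symProd α₁ α₂ α₃ α₃
  + (4 * h) • symProd α₁ α₃ α₃ α₃
  + (1 + d ^ 2) • symProd α₂ α₂ α₂ α₂
  + (4 * d * g) • symProd α₂ α₂ α₂ α₃
  + (6 * (1 + d * h)) • symProd α₂ α₂ α₃ α₃
  + (4 * g * (d + h)) • symProd α₂ α₃ α₃ α₃
  + (1 + g ^ 2 + h ^ 2) • symProd α₃ α₃ α₃ α₃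
  + (2 * (g ^ 2 + d ^ 2 - 1 - d * h)) • tensSq α₂ α₃

/-- The elastic positivity bounds: `M(S) ≥ 0` on the extremal rays of the first kind, `S = α⁴`,
and of the second kind, `S = (α₁ ∨ α₂)^{⊗2} + (α₁ ∧ α₂)^{⊗2}`. -/
def ElasticBounds (M : Module.Dual ℝ (W V)) : Prop :=
  (∀ α : Module.Dual ℝ V, α ≠ 0 → 0 ≤ M (symProd α α α α)) ∧
  (∀ α₁ α₂ : Module.Dual ℝ V, LinearIndependent ℝ ![α₁, α₂] → 0 ≤ M (veeWedge α₁ α₂))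

/-- The inelastic positivity bounds (for `dim V = 3`): `M(S) ≥ 0` on the extremal rays of the
third kind. -/
def InelasticBounds (M : Module.Dual ℝ (W V)) : Prop :=
  ∀ (α : Module.Basis (Fin 3) ℝ (Module.Dual ℝ V)) (d g h : ℝ), g ^ 2 > 1 - d ^ 2 + d * h →
    0 ≤ M (thirdKind (α 0) (α 1) (α 2) d g h)

/-- Pull-back of four-tensors in `W` along a linear map `f : V → V`,
`(f^* S)(v₁,v₂,v₃,v₄) = S(f v₁, f v₂, f v₃, f v₄)`. -/
def pullback (f : V →ₗ[ℝ] V) : W V →ₗ[ℝ] W V where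
  toFun S := ⟨(S : FourTensor V).compl₁₂ (TensorProduct.map f f) (TensorProduct.map f f), by
    rw [mem_W_iff]
    intro a b c d
    simpa using mem_W_iff.1 S.2 (f a) (f b) (f c) (f d)⟩
  map_add' S T := by
    apply Subtype.ext
    ext
    simp
  map_smul' c S := by
    apply Subtype.ext
    ext
    simp

/-- The functional on `W` given by a contravariant four-tensor through the natural pairing
of `V^{⊗4}` with `V*^{⊗4}`. -/
def functional (T : (V ⊗[ℝ] V) ⊗[ℝ] (V ⊗[ℝ] V)) : Module.Dual ℝ (W V) where
  toFun S := TensorProduct.lift (S : FourTensor V) T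
  map_add' S S' := by
    change TensorProduct.uncurry (RingHom.id ℝ) (V ⊗[ℝ] V) (V ⊗[ℝ] V) ℝ _ T = _
    rw [Submodule.coe_add, map_add]
    rfl
  map_smul' c S := by
    change TensorProduct.uncurry (RingHom.id ℝ) (V ⊗[ℝ] V) (V ⊗[ℝ] V) ℝ _ T = _
    rw [Submodule.coe_smul, map_smul]
    rfl

end General

section ThreeFlavors

variable {V : Type*} [AddCommGroup V] [Module ℝ V]

/-- `(W*)^{O(3)}`: the group `O(3)` acts on `V` through the identification `V ≅ ℝ³` given by the
basis `e`, and on `W*` by the induced action `(A · M)(S) = M(A^* S)`. -/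
def orthogonalInvariants (e : Module.Basis (Fin 3) ℝ V) :
    Submodule ℝ (Module.Dual ℝ (W V)) where
  carrier := {M | ∀ A ∈ Matrix.orthogonalGroup (Fin 3) ℝ,
    M ∘ₗ pullback (Matrix.toLin e e A) = M}
  add_mem' := by
    intro M N hM hN A hA
    rw [LinearMap.add_comp, hM A hA, hN A hA]
  zero_mem' := by
    intro A _
    rw [LinearMap.zero_comp]
  smul_mem' := by
    intro c M hM A hA
    rw [LinearMap.smul_comp, hM A hA]

/-- `v ∨ w` for vectors. -/
def veeVec (v w : V) : V ⊗[ℝ] V := (1 / 2 : ℝ) • (v ⊗ₜ[ℝ] w + w ⊗ₜ[ℝ] v)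

/-- `v ∧ w` for vectors. -/
def wedgeVec (v w : V) : V ⊗[ℝ] V := (1 / 2 : ℝ) • (v ⊗ₜ[ℝ] w - w ⊗ₜ[ℝ] v)

/-- `Q^{⊗2}` for a two-tensor `Q`. -/
def tensorSq (Q : V ⊗[ℝ] V) : (V ⊗[ℝ] V) ⊗[ℝ] (V ⊗[ℝ] V) := Q ⊗ₜ[ℝ] Q

/-- The contravariant four-tensor
`a₁ (e₁² + e₂² + e₃²)^{⊗2} + a₂ (e₁⁴ + e₂⁴ + e₃⁴ + 2 (e₁∨e₂)^{⊗2} + 2 (e₁∨e₃)^{⊗2} + 2 (e₂∨e₃)^{⊗2})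
+ a₃ ((e₁∧e₂)^{⊗2} + (e₁∧e₃)^{⊗2} + (e₂∧e₃)^{⊗2})`. -/
def invTensor (e : Module.Basis (Fin 3) ℝ V) (a₁ a₂ a₃ : ℝ) :
    (V ⊗[ℝ] V) ⊗[ℝ] (V ⊗[ℝ] V) :=
  a₁ • tensorSq (e 0 ⊗ₜ[ℝ] e 0 + e 1 ⊗ₜ[ℝ] e 1 + e 2 ⊗ₜ[ℝ] e 2)
  + a₂ • (tensorSq (e 0 ⊗ₜ[ℝ] e 0) + tensorSq (e 1 ⊗ₜ[ℝ] e 1) + tensorSq (e 2 ⊗ₜ[ℝ] e 2)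
      + (2 : ℝ) • tensorSq (veeVec (e 0) (e 1)) + (2 : ℝ) • tensorSq (veeVec (e 0) (e 2))
      + (2 : ℝ) • tensorSq (veeVec (e 1) (e 2)))
  + a₃ • (tensorSq (wedgeVec (e 0) (e 1)) + tensorSq (wedgeVec (e 0) (e 2)) + tensorSq (wedgeVec (e 1) (e 2)))

/-- The element of `W*` with coefficients `a₁, a₂`. The value `a₃ = 2 a₂ - 4 a₁` is the one for
which the tensor is fixed by the exchange of the second and fourth factor, i.e. for which it has
the symmetries of `W*`. -/
def invElement (e : Module.Basis (Fin 3) ℝ V) (a₁ a₂ : ℝ) : Module.Dual ℝ (W V) :=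
  functional (invTensor e a₁ a₂ (2 * a₂ - 4 * a₁))

/-- The four-tensor of forward two-to-two pion scattering in chiral perturbation theory,
with low-energy parameters `ℓ₁, ℓ₂`. -/
def pionElement (e : Module.Basis (Fin 3) ℝ V) (l₁ l₂ : ℝ) : Module.Dual ℝ (W V) :=
  functional (
    (2 * l₁ + 3 * l₂) • (tensorSq (e 0 ⊗ₜ[ℝ] e 0) + tensorSq (e 1 ⊗ₜ[ℝ] e 1) + tensorSq (e 2 ⊗ₜ[ℝ] e 2)
      + (2 : ℝ) • tensorSq (veeVec (e 0) (e 1)) + (2 : ℝ) • tensorSq (veeVec (e 0) (e 2))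
      + (2 : ℝ) • tensorSq (veeVec (e 1) (e 2)))
    + (2 * l₁ + l₂) • tensorSq (e 0 ⊗ₜ[ℝ] e 0 + e 1 ⊗ₜ[ℝ] e 1 + e 2 ⊗ₜ[ℝ] e 2)
    + (2 * (l₂ - 2 * l₁)) •
      (tensorSq (wedgeVec (e 0) (e 1)) + tensorSq (wedgeVec (e 0) (e 2)) + tensorSq (wedgeVec (e 1) (e 2))))

end ThreeFlavors

end FlavorCone

end

open scoped TensorProduct

noncomputable section

namespace FlavorCone

section PositiveTensors

variable {V : Type*} [AddCommGroup V] [Module ℝ V]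

theorem W_symm (S : W V) (a b c d : V) :
    (S : FourTensor V) (a ⊗ₜ[ℝ] b) (c ⊗ₜ[ℝ] d) = (S : FourTensor V) (c ⊗ₜ[ℝ] d) (a ⊗ₜ[ℝ] b) :=
  (mem_W_iff.1 S.2 a b c d).1

theorem W_flip (S : W V) (a b c d : V) :
    (S : FourTensor V) (a ⊗ₜ[ℝ] b) (c ⊗ₜ[ℝ] d) = (S : FourTensor V) (b ⊗ₜ[ℝ] a) (d ⊗ₜ[ℝ] c) :=
  (mem_W_iff.1 S.2 a b c d).2.1

theorem W_tau (S : W V) (a b c d : V) :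
    (S : FourTensor V) (a ⊗ₜ[ℝ] d) (c ⊗ₜ[ℝ] b) = (S : FourTensor V) (a ⊗ₜ[ℝ] b) (c ⊗ₜ[ℝ] d) :=
  (mem_W_iff.1 S.2 a b c d).2.2

theorem W_isSymm (S : W V) (p q : V ⊗[ℝ] V) :
    (S : FourTensor V) p q = (S : FourTensor V) q p := by
  have h : (S : FourTensor V) = (S : FourTensor V).flip := by
    ext a b c d
    simpa using W_symm S a b c d
  exact LinearMap.congr_fun (LinearMap.congr_fun h p) q

theorem mem_positivityCone_iff {S : W V} :
    S ∈ positivityCone V ↔ ∀ p, 0 ≤ (S : FourTensor V) p p := by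
  constructor
  · intro h p
    exact h.isNonneg.nonneg p
  · intro h
    exact { eq := W_isSymm S, nonneg := h }

theorem mem_dualCone_iff {M : Module.Dual ℝ (W V)} :
    M ∈ dualCone V ↔ ∀ S : W V, (∀ p, 0 ≤ (S : FourTensor V) p p) → 0 ≤ M S := by
  simp only [dualCone, PointedCone.mem_dual, mem_positivityCone_iff, Module.Dual.eval_apply]

theorem symProd_apply (α β γ δ : Module.Dual ℝ V) (a b c d : V) :
    (symProd α β γ δ : FourTensor V) (a ⊗ₜ[ℝ] b) (c ⊗ₜ[ℝ] d) = (1 / 24 : ℝ) * (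
      α a * β b * γ c * δ d + α a * β b * δ c * γ d + α a * γ b * β c * δ d
      + α a * γ b * δ c * β d + α a * δ b * β c * γ d + α a * δ b * γ c * β d
      + β a * α b * γ c * δ d + β a * α b * δ c * γ d + β a * γ b * α c * δ d
      + β a * γ b * δ c * α d + β a * δ b * α c * γ d + β a * δ b * γ c * α d
      + γ a * α b * β c * δ d + γ a * α b * δ c * β d + γ a * β b * α c * δ d
      + γ a * β b * δ c * α d + γ a * δ b * α c * β d + γ a * δ b * β c * α d
      + δ a * α b * β c * γ d + δ a * α b * γ c * β d + δ a * β b * α c * γ d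
      + δ a * β b * γ c * α d + δ a * γ b * α c * β d + δ a * γ b * β c * α d) := by
  have h := symProdTensor_apply ![α, β, γ, δ] ![a, b, c, d]
  simp only [Matrix.cons_val] at h
  change symProdTensor ![α, β, γ, δ] _ _ = _
  rw [h]
  congr 1
  rw [← (Equiv.Perm.decomposeFin (n := 3)).symm.sum_comp, Fintype.sum_prod_type]
  simp_rw [← (Equiv.Perm.decomposeFin (n := 2)).symm.sum_comp, Fintype.sum_prod_type,
    ← (Equiv.Perm.decomposeFin (n := 1)).symm.sum_comp, Fintype.sum_prod_type]
  simp [Fin.sum_univ_succ, Fin.prod_univ_succ, Equiv.Perm.decomposeFin, Equiv.swap_apply_def]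
  ring

theorem symProd_self (α : Module.Dual ℝ V) :
    (symProd α α α α : FourTensor V) = pair (tens α α) (tens α α) := by
  ext a b c d
  simp [symProd_apply]
  ring

theorem symProd_self_nonneg (α : Module.Dual ℝ V) (p : V ⊗[ℝ] V) :
    0 ≤ (symProd α α α α : FourTensor V) p p := by
  rw [symProd_self, pair_apply]
  exact mul_self_nonneg _

theorem veeWedge_nonneg (α β : Module.Dual ℝ V) (p : V ⊗[ℝ] V) :
    0 ≤ (veeWedge α β : FourTensor V) p p := by
  simp only [veeWedge, LinearMap.add_apply, pair_apply]
  exact add_nonneg (mul_self_nonneg _) (mul_self_nonneg _)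

theorem thirdKind_eq_sum_squares (α β γ : Module.Dual ℝ V) (d g h : ℝ) :
    (thirdKind α β γ d g h : FourTensor V) =
      pair (tens α α + tens β β + tens γ γ) (tens α α + tens β β + tens γ γ)
      + pair (tens α β + tens β α + g • tens γ γ + d • (tens β γ + tens γ β))
          (tens α β + tens β α + g • tens γ γ + d • (tens β γ + tens γ β))
      + pair (tens α γ + tens γ α + d • tens β β + h • tens γ γ + g • (tens β γ + tens γ β))
          (tens α γ + tens γ α + d • tens β β + h • tens γ γ + g • (tens β γ + tens γ β))
      + (g ^ 2 + d ^ 2 - 1 - d * h) • pair (tens β γ - tens γ β) (tens β γ - tens γ β) := by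
  ext v₁ v₂ v₃ v₄
  simp [thirdKind, symProd_apply, tensSq]
  ring

theorem thirdKind_nonneg (α β γ : Module.Dual ℝ V) {d g h : ℝ}
    (hg : g ^ 2 > 1 - d ^ 2 + d * h) (p : V ⊗[ℝ] V) :
    0 ≤ (thirdKind α β γ d g h : FourTensor V) p p := by
  rw [thirdKind_eq_sum_squares]
  simp only [LinearMap.add_apply, LinearMap.smul_apply, pair_apply, smul_eq_mul]
  have hk : 0 ≤ g ^ 2 + d ^ 2 - 1 - d * h := by linarith
  exact add_nonneg (add_nonneg (add_nonneg (mul_self_nonneg _) (mul_self_nonneg _))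
    (mul_self_nonneg _)) (mul_nonneg hk (mul_self_nonneg _))

theorem elasticBounds_of_mem_dualCone {M : Module.Dual ℝ (W V)} (hM : M ∈ dualCone V) :
    ElasticBounds M :=
  ⟨fun α _ => mem_dualCone_iff.1 hM _ (symProd_self_nonneg α),
    fun α β _ => mem_dualCone_iff.1 hM _ (veeWedge_nonneg α β)⟩

theorem inelasticBounds_of_mem_dualCone {M : Module.Dual ℝ (W V)} (hM : M ∈ dualCone V) :
    InelasticBounds M := by
  intro α d g h hg
  have h0 := thirdKind_nonneg (α 0) (α 1) (α 2) hg
  exact mem_dualCone_iff.1 hM (thirdKind (α 0) (α 1) (α 2) d g h) h0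

end PositiveTensors

section Contractions

variable {V : Type*} [AddCommGroup V] [Module ℝ V]

/-- The contraction `∑ᵢⱼ Sᵢᵢⱼⱼ` in the basis `e`. -/
def diagContraction (e : Module.Basis (Fin 3) ℝ V) (S : FourTensor V) : ℝ :=
  ∑ i, ∑ j, S (e i ⊗ₜ[ℝ] e i) (e j ⊗ₜ[ℝ] e j)

/-- The contraction `∑ᵢⱼ Sᵢⱼᵢⱼ` in the basis `e`. -/
def traceContraction (e : Module.Basis (Fin 3) ℝ V) (S : FourTensor V) : ℝ :=
  ∑ i, ∑ j, S (e i ⊗ₜ[ℝ] e j) (e i ⊗ₜ[ℝ] e j)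

variable (e : Module.Basis (Fin 3) ℝ V)

theorem functional_tensorSq (Q : V ⊗[ℝ] V) (S : W V) :
    functional (tensorSq Q) S = (S : FourTensor V) Q Q := by
  simp [functional, tensorSq]

theorem functional_add (T T' : (V ⊗[ℝ] V) ⊗[ℝ] (V ⊗[ℝ] V)) (S : W V) :
    functional (T + T') S = functional T S + functional T' S := by
  simp [functional]

theorem functional_smul (c : ℝ) (T : (V ⊗[ℝ] V) ⊗[ℝ] (V ⊗[ℝ] V)) (S : W V) :
    functional (c • T) S = c * functional T S := by
  simp [functional]

theorem invElement_apply (a₁ a₂ : ℝ) (S : W V) :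
    invElement e a₁ a₂ S =
      2 * a₁ * diagContraction e S + (a₂ - a₁) * traceContraction e S := by
  have h : ∀ i j, (S : FourTensor V) (e i ⊗ₜ[ℝ] e j) (e j ⊗ₜ[ℝ] e i)
      = (S : FourTensor V) (e i ⊗ₜ[ℝ] e i) (e j ⊗ₜ[ℝ] e j) := fun i j =>
    (mem_W_iff.1 S.2 (e i) (e i) (e j) (e j)).2.2
  simp only [invElement, invTensor, functional_add, functional_smul, functional_tensorSq,
    veeVec, wedgeVec, map_add, map_sub, map_smul, LinearMap.add_apply, LinearMap.sub_apply,
    LinearMap.smul_apply, smul_eq_mul, h 0 1, h 1 0, h 0 2, h 2 0,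
    h 1 2, h 2 1, diagContraction, traceContraction,
    Fin.sum_univ_three]
  ring

theorem pionElement_eq (l₁ l₂ : ℝ) :
    pionElement e l₁ l₂ = invElement e (2 * l₁ + l₂) (2 * l₁ + 3 * l₂) := by
  rw [pionElement, invElement, invTensor]
  congr 2
  · exact add_comm _ _
  · congr 1
    ring

theorem diagContraction_nonneg {S : FourTensor V} (hS : ∀ p, 0 ≤ S p p) :
    0 ≤ diagContraction e S := by
  have h := hS (∑ i, e i ⊗ₜ[ℝ] e i)
  simp only [map_sum, LinearMap.sum_apply] at h
  rwa [diagContraction, Finset.sum_comm]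

theorem traceContraction_nonneg {S : FourTensor V} (hS : ∀ p, 0 ≤ S p p) :
    0 ≤ traceContraction e S :=
  Finset.sum_nonneg fun _ _ => Finset.sum_nonneg fun _ _ => hS _

theorem diagContraction_le_traceContraction {S : W V}
    (hS : ∀ p, 0 ≤ (S : FourTensor V) p p) :
    diagContraction e S ≤ traceContraction e S := by
  have h : ∀ i j, (S : FourTensor V) (e i ⊗ₜ[ℝ] e j) (e j ⊗ₜ[ℝ] e i)
      = (S : FourTensor V) (e i ⊗ₜ[ℝ] e i) (e j ⊗ₜ[ℝ] e j) := fun i j =>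
    (mem_W_iff.1 S.2 (e i) (e i) (e j) (e j)).2.2
  have h01 := hS (e 0 ⊗ₜ[ℝ] e 1 - e 1 ⊗ₜ[ℝ] e 0)
  have h02 := hS (e 0 ⊗ₜ[ℝ] e 2 - e 2 ⊗ₜ[ℝ] e 0)
  have h12 := hS (e 1 ⊗ₜ[ℝ] e 2 - e 2 ⊗ₜ[ℝ] e 1)
  simp only [map_sub, LinearMap.sub_apply, h 0 1, h 1 0, h 0 2, h 2 0, h 1 2, h 2 1] at h01 h02 h12
  simp only [diagContraction, traceContraction, Fin.sum_univ_three]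
  linarith

theorem invElement_mem_dualCone {a₁ a₂ : ℝ} (h : |a₁| ≤ a₂) :
    invElement e a₁ a₂ ∈ dualCone V := by
  refine mem_dualCone_iff.2 fun S hS => ?_
  rw [invElement_apply]
  obtain ⟨h1, h2⟩ := abs_le.1 h
  have hA := diagContraction_nonneg e hS
  have hB := traceContraction_nonneg e hS
  have hAB := diagContraction_le_traceContraction e hS
  rcases le_total 0 a₁ with h0 | h0
  · exact add_nonneg (mul_nonneg (by linarith) hA) (mul_nonneg (by linarith) hB)
  · have h3 := mul_nonneg (neg_nonneg.2 h0) (sub_nonneg.2 hAB)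
    have h4 : 0 ≤ (a₂ + a₁) * traceContraction e (S : FourTensor V) :=
      mul_nonneg (by linarith) hB
    nlinarith

theorem sum_bilin_toLin_orthogonal {A : Matrix (Fin 3) (Fin 3) ℝ}
    (hA : A ∈ Matrix.orthogonalGroup (Fin 3) ℝ) (b : V →ₗ[ℝ] V →ₗ[ℝ] ℝ) :
    ∑ i, b (Matrix.toLin e e A (e i)) (Matrix.toLin e e A (e i)) = ∑ i, b (e i) (e i) := by
  have hA' : ∀ j k, ∑ i, A j i * A k i = if j = k then 1 else 0 := by
    intro j k
    have h := congr_fun (congr_fun ((Matrix.mem_orthogonalGroup_iff (Fin 3) ℝ).1 hA) j) k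
    simpa [Matrix.mul_apply, Matrix.one_apply] using h
  simp only [Matrix.toLin_self, map_sum, map_smul, LinearMap.sum_apply, LinearMap.smul_apply,
    smul_eq_mul]
  have h : ∑ i, ∑ k, A k i * ∑ j, A j i * b (e j) (e k)
      = ∑ k, ∑ j, (∑ i, A k i * A j i) * b (e j) (e k) := by
    simp only [Finset.mul_sum, Finset.sum_mul]
    rw [Finset.sum_comm]
    refine Finset.sum_congr rfl fun k _ => ?_
    rw [Finset.sum_comm]
    simp only [mul_assoc]
  rw [h]
  simp [hA']

theorem pullback_apply_tmul (f : V →ₗ[ℝ] V) (S : W V) (a b c d : V) :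
    (pullback f S : FourTensor V) (a ⊗ₜ[ℝ] b) (c ⊗ₜ[ℝ] d)
      = (S : FourTensor V) (f a ⊗ₜ[ℝ] f b) (f c ⊗ₜ[ℝ] f d) := by
  simp [pullback]

theorem diagContraction_pullback_orthogonal {A : Matrix (Fin 3) (Fin 3) ℝ}
    (hA : A ∈ Matrix.orthogonalGroup (Fin 3) ℝ) (S : W V) :
    diagContraction e (pullback (Matrix.toLin e e A) S : FourTensor V) = diagContraction e S := by
  have h : ∑ i, Matrix.toLin e e A (e i) ⊗ₜ[ℝ] Matrix.toLin e e A (e i)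
      = ∑ i, e i ⊗ₜ[ℝ] e i := by
    refine Module.forall_dual_apply_eq_zero_iff ℝ _ |>.1 (fun φ => ?_) |> sub_eq_zero.1
    have h := sum_bilin_toLin_orthogonal e hA (TensorProduct.curry φ)
    rw [map_sub, map_sum, map_sum, sub_eq_zero]
    exact h
  have hS : ∀ v : Fin 3 → V, ∑ i, ∑ j, (S : FourTensor V) (v i ⊗ₜ[ℝ] v i) (v j ⊗ₜ[ℝ] v j)
      = (S : FourTensor V) (∑ i, v i ⊗ₜ[ℝ] v i) (∑ i, v i ⊗ₜ[ℝ] v i) := by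
    intro v
    simp only [map_sum, LinearMap.sum_apply]
    exact Finset.sum_comm
  simp only [diagContraction, pullback_apply_tmul]
  rw [hS, hS, h]

theorem traceContraction_pullback_orthogonal {A : Matrix (Fin 3) (Fin 3) ℝ}
    (hA : A ∈ Matrix.orthogonalGroup (Fin 3) ℝ) (S : W V) :
    traceContraction e (pullback (Matrix.toLin e e A) S : FourTensor V)
      = traceContraction e S := by
  simp only [traceContraction, pullback_apply_tmul]
  have h₁ : ∀ v : V, ∑ j, (S : FourTensor V) (v ⊗ₜ[ℝ] Matrix.toLin e e A (e j))
      (v ⊗ₜ[ℝ] Matrix.toLin e e A (e j)) = ∑ j, (S : FourTensor V) (v ⊗ₜ[ℝ] e j) (v ⊗ₜ[ℝ] e j) :=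
    fun v => sum_bilin_toLin_orthogonal e hA
      ((S : FourTensor V).compl₁₂ (TensorProduct.mk ℝ V V v) (TensorProduct.mk ℝ V V v))
  have h₂ : ∀ w : V, ∑ i, (S : FourTensor V) (Matrix.toLin e e A (e i) ⊗ₜ[ℝ] w)
      (Matrix.toLin e e A (e i) ⊗ₜ[ℝ] w) = ∑ i, (S : FourTensor V) (e i ⊗ₜ[ℝ] w) (e i ⊗ₜ[ℝ] w) :=
    fun w => sum_bilin_toLin_orthogonal e hA ((S : FourTensor V).compl₁₂
      ((TensorProduct.mk ℝ V V).flip w) ((TensorProduct.mk ℝ V V).flip w))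
  simp only [h₁]
  rw [Finset.sum_comm]
  simp only [h₂]
  exact Finset.sum_comm

theorem invElement_mem_orthogonalInvariants (a₁ a₂ : ℝ) :
    invElement e a₁ a₂ ∈ orthogonalInvariants e := by
  intro A hA
  ext S
  rw [LinearMap.comp_apply, invElement_apply, invElement_apply,
    diagContraction_pullback_orthogonal e hA, traceContraction_pullback_orthogonal e hA]

/-- The inner product of one-forms for which the dual basis of `e` is orthonormal. -/
def dualInner (α β : Module.Dual ℝ V) : ℝ := ∑ i, α (e i) * β (e i)

theorem invElement_symProd_self (a₁ a₂ : ℝ) (α : Module.Dual ℝ V) :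
    invElement e a₁ a₂ (symProd α α α α) = (a₁ + a₂) * dualInner e α α ^ 2 := by
  rw [invElement_apply, symProd_self]
  simp only [diagContraction, traceContraction, dualInner, pair_apply, tens_apply,
    Fin.sum_univ_three]
  ring

theorem invElement_veeWedge (a₁ a₂ : ℝ) (α β : Module.Dual ℝ V) :
    invElement e a₁ a₂ (veeWedge α β) = 2 * a₁ * dualInner e α β ^ 2
      + (a₂ - a₁) * (dualInner e α α * dualInner e β β) := by
  rw [invElement_apply]
  simp only [diagContraction, traceContraction, dualInner, veeWedge, vee, wedge,
    LinearMap.add_apply, LinearMap.sub_apply, LinearMap.smul_apply, smul_eq_mul, pair_apply,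
    tens_apply, Fin.sum_univ_three]
  ring

theorem dualInner_coord (i j : Fin 3) :
    dualInner e (e.coord i) (e.coord j) = if i = j then 1 else 0 := by
  simp [dualInner, Finsupp.single_apply, eq_comm]

theorem elasticBounds_invElement_iff (a₁ a₂ : ℝ) :
    ElasticBounds (invElement e a₁ a₂) ↔ a₂ ≥ |a₁| := by
  constructor
  · rintro ⟨h1, h2⟩
    have hli := e.dualBasis.linearIndependent
    have h0 : e.coord 0 ≠ 0 := by
      simpa using hli.ne_zero 0
    have h01 : LinearIndependent ℝ ![e.coord 0, e.coord 1] := by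
      have h := hli.comp ![0, 1] (by decide)
      have h' : ![e.coord 0, e.coord 1] = e.dualBasis ∘ ![0, 1] := by
        ext i
        fin_cases i <;> simp
      rwa [h']
    have h3 := h1 _ h0
    have h4 := h2 _ _ h01
    rw [invElement_symProd_self, dualInner_coord] at h3
    simp only [invElement_veeWedge, dualInner_coord] at h4
    norm_num at h3 h4
    exact abs_le.2 ⟨by linarith, h4⟩
  · intro h
    exact elasticBounds_of_mem_dualCone (invElement_mem_dualCone e h)

theorem invElement_injective {a₁ a₂ b₁ b₂ : ℝ}
    (h : invElement e a₁ a₂ = invElement e b₁ b₂) : a₁ = b₁ ∧ a₂ = b₂ := by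
  have h1 := LinearMap.congr_fun h (symProd (e.coord 0) (e.coord 0) (e.coord 0) (e.coord 0))
  have h2 := LinearMap.congr_fun h (veeWedge (e.coord 0) (e.coord 1))
  simp only [invElement_symProd_self, invElement_veeWedge, dualInner_coord] at h1 h2
  norm_num at h1 h2
  constructor <;> linarith

end Contractions

section Invariants

variable {V : Type*} [AddCommGroup V] [Module ℝ V]

/-- The projection of `α ⊗ β ⊗ γ ⊗ δ` to `W`: the average over the symmetries of `W`. -/
def symTensor (α β γ δ : Module.Dual ℝ V) : W V :=
  ⟨(1 / 8 : ℝ) • (pair (tens α β) (tens γ δ) + pair (tens γ β) (tens α δ)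
    + pair (tens α δ) (tens γ β) + pair (tens γ δ) (tens α β)
    + pair (tens β α) (tens δ γ) + pair (tens δ α) (tens β γ)
    + pair (tens β γ) (tens δ α) + pair (tens δ γ) (tens β α)), by
    rw [mem_W_iff]
    intro a b c d
    refine ⟨?_, ?_, ?_⟩ <;> simp <;> ring⟩

theorem symTensor_apply (α β γ δ : Module.Dual ℝ V) (a b c d : V) :
    (symTensor α β γ δ : FourTensor V) (a ⊗ₜ[ℝ] b) (c ⊗ₜ[ℝ] d) = (1 / 8 : ℝ) * (
      α a * β b * (γ c * δ d) + γ a * β b * (α c * δ d)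
      + α a * δ b * (γ c * β d) + γ a * δ b * (α c * β d)
      + β a * α b * (δ c * γ d) + δ a * α b * (β c * γ d)
      + β a * γ b * (δ c * α d) + δ a * γ b * (β c * α d)) := by
  simp only [symTensor, LinearMap.smul_apply, LinearMap.add_apply, pair_apply, tens_apply,
    smul_eq_mul]

theorem W_ext {S T : W V} (h : ∀ a b c d : V, (S : FourTensor V) (a ⊗ₜ[ℝ] b) (c ⊗ₜ[ℝ] d)
    = (T : FourTensor V) (a ⊗ₜ[ℝ] b) (c ⊗ₜ[ℝ] d)) : S = T := by
  apply Subtype.ext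
  ext a b c d
  exact h a b c d

theorem symTensor_comm_even (α β γ δ : Module.Dual ℝ V) :
    symTensor α β γ δ = symTensor α δ γ β :=
  W_ext fun a b c d => by
    simp only [symTensor_apply]
    ring

theorem pullback_symTensor (f : V →ₗ[ℝ] V) (α β γ δ : Module.Dual ℝ V) :
    pullback f (symTensor α β γ δ) = symTensor (α ∘ₗ f) (β ∘ₗ f) (γ ∘ₗ f) (δ ∘ₗ f) :=
  W_ext fun a b c d => by
    simp only [pullback_apply_tmul, symTensor_apply, LinearMap.comp_apply]

theorem symTensor_smul (r s t u : ℝ) (α β γ δ : Module.Dual ℝ V) :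
    symTensor (r • α) (s • β) (t • γ) (u • δ) = (r * s * t * u) • symTensor α β γ δ :=
  W_ext fun a b c d => by
    simp only [Submodule.coe_smul, symTensor_apply, LinearMap.smul_apply, smul_eq_mul]
    ring

theorem symTensor_self_add (x y : ℝ) (α β : Module.Dual ℝ V) :
    symTensor (x • α + y • β) (x • α + y • β) (x • α + y • β) (x • α + y • β) =
      x ^ 4 • symTensor α α α α + y ^ 4 • symTensor β β β β
      + (4 * x ^ 2 * y ^ 2) • symTensor α α β β + (2 * x ^ 2 * y ^ 2) • symTensor α β α β
      + (4 * x ^ 3 * y) • symTensor α α α β + (4 * x * y ^ 3) • symTensor α β β β :=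
  W_ext fun a b c d => by
    simp only [Submodule.coe_add, Submodule.coe_smul, symTensor_apply, LinearMap.add_apply,
      LinearMap.smul_apply, smul_eq_mul]
    ring

variable (e : Module.Basis (Fin 3) ℝ V)

theorem FourTensor_expand (S : FourTensor V) (a b c d : V) :
    ∑ i, ∑ j, ∑ k, ∑ l, S (e i ⊗ₜ[ℝ] e j) (e k ⊗ₜ[ℝ] e l) *
      (e.coord i a * e.coord j b * (e.coord k c * e.coord l d)) = S (a ⊗ₜ[ℝ] b) (c ⊗ₜ[ℝ] d) := by
  have h : ∀ v w : V, v ⊗ₜ[ℝ] w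
      = ∑ i, ∑ j, (e.coord i v * e.coord j w) • (e i ⊗ₜ[ℝ] e j) := by
    intro v w
    conv_lhs => rw [← e.sum_repr v, ← e.sum_repr w]
    simp only [TensorProduct.sum_tmul, TensorProduct.tmul_sum, TensorProduct.smul_tmul_smul,
      Module.Basis.coord_apply]
    exact Finset.sum_comm
  rw [h a b]
  simp only [map_sum, LinearMap.sum_apply, map_smul, LinearMap.smul_apply, smul_eq_mul]
  refine Finset.sum_congr rfl fun i _ => Finset.sum_congr rfl fun j _ => ?_
  rw [h c d]
  simp only [map_sum, map_smul, smul_eq_mul, Finset.mul_sum]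
  refine Finset.sum_congr rfl fun k _ => Finset.sum_congr rfl fun l _ => ?_
  ring

theorem W_expand (S : W V) :
    S = ∑ i, ∑ j, ∑ k, ∑ l, (S : FourTensor V) (e i ⊗ₜ[ℝ] e j) (e k ⊗ₜ[ℝ] e l) •
      symTensor (e.coord i) (e.coord j) (e.coord k) (e.coord l) := by
  refine W_ext fun a b c d => ?_
  have h := FourTensor_expand e (S : FourTensor V)
  simp only [Submodule.coe_sum, Submodule.coe_smul, LinearMap.sum_apply, LinearMap.smul_apply,
    smul_eq_mul, symTensor_apply]
  have h' : ∀ i j k l, (S : FourTensor V) (e i ⊗ₜ[ℝ] e j) (e k ⊗ₜ[ℝ] e l) * ((1 / 8 : ℝ) * (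
      e.coord i a * e.coord j b * (e.coord k c * e.coord l d)
      + e.coord k a * e.coord j b * (e.coord i c * e.coord l d)
      + e.coord i a * e.coord l b * (e.coord k c * e.coord j d)
      + e.coord k a * e.coord l b * (e.coord i c * e.coord j d)
      + e.coord j a * e.coord i b * (e.coord l c * e.coord k d)
      + e.coord l a * e.coord i b * (e.coord j c * e.coord k d)
      + e.coord j a * e.coord k b * (e.coord l c * e.coord i d)
      + e.coord l a * e.coord k b * (e.coord j c * e.coord i d)))
      = (1 / 8 : ℝ) * (
      (S : FourTensor V) (e i ⊗ₜ[ℝ] e j) (e k ⊗ₜ[ℝ] e l) *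
        (e.coord i a * e.coord j b * (e.coord k c * e.coord l d))
      + (S : FourTensor V) (e i ⊗ₜ[ℝ] e j) (e k ⊗ₜ[ℝ] e l) *
        (e.coord i c * e.coord j b * (e.coord k a * e.coord l d))
      + (S : FourTensor V) (e i ⊗ₜ[ℝ] e j) (e k ⊗ₜ[ℝ] e l) *
        (e.coord i a * e.coord j d * (e.coord k c * e.coord l b))
      + (S : FourTensor V) (e i ⊗ₜ[ℝ] e j) (e k ⊗ₜ[ℝ] e l) *
        (e.coord i c * e.coord j d * (e.coord k a * e.coord l b))
      + (S : FourTensor V) (e i ⊗ₜ[ℝ] e j) (e k ⊗ₜ[ℝ] e l) *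
        (e.coord i b * e.coord j a * (e.coord k d * e.coord l c))
      + (S : FourTensor V) (e i ⊗ₜ[ℝ] e j) (e k ⊗ₜ[ℝ] e l) *
        (e.coord i b * e.coord j c * (e.coord k d * e.coord l a))
      + (S : FourTensor V) (e i ⊗ₜ[ℝ] e j) (e k ⊗ₜ[ℝ] e l) *
        (e.coord i d * e.coord j a * (e.coord k b * e.coord l c))
      + (S : FourTensor V) (e i ⊗ₜ[ℝ] e j) (e k ⊗ₜ[ℝ] e l) *
        (e.coord i d * e.coord j c * (e.coord k b * e.coord l a))) := by
    intro i j k l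
    ring
  simp only [h', ← Finset.mul_sum, Finset.sum_add_distrib, h]
  linarith [W_symm S a b c d, W_symm S b a d c, W_flip S a b c d, W_tau S a b c d,
    W_symm S a d c b, W_flip S a d c b, W_symm S b c d a]

theorem coord_comp_toLin (A : Matrix (Fin 3) (Fin 3) ℝ) (i : Fin 3) :
    e.coord i ∘ₗ Matrix.toLin e e A = ∑ j, A i j • e.coord j := by
  refine e.ext fun k => ?_
  simp [Matrix.toLin_self, Finsupp.single_apply, LinearMap.sum_apply]

variable {e}

theorem invariant_symTensor {M : Module.Dual ℝ (W V)} (hM : M ∈ orthogonalInvariants e)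
    {A : Matrix (Fin 3) (Fin 3) ℝ} (hA : A ∈ Matrix.orthogonalGroup (Fin 3) ℝ)
    (α β γ δ : Module.Dual ℝ V) :
    M (symTensor (α ∘ₗ Matrix.toLin e e A) (β ∘ₗ Matrix.toLin e e A)
      (γ ∘ₗ Matrix.toLin e e A) (δ ∘ₗ Matrix.toLin e e A)) = M (symTensor α β γ δ) := by
  rw [← pullback_symTensor]
  exact LinearMap.congr_fun (hM A hA) _

theorem invariant_symTensor_perm {M : Module.Dual ℝ (W V)} (hM : M ∈ orthogonalInvariants e)
    (σ : Equiv.Perm (Fin 3)) (i j k l : Fin 3) :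
    M (symTensor (e.coord (σ i)) (e.coord (σ j)) (e.coord (σ k)) (e.coord (σ l)))
      = M (symTensor (e.coord i) (e.coord j) (e.coord k) (e.coord l)) := by
  let A : Matrix (Fin 3) (Fin 3) ℝ := Matrix.of fun i j => if σ i = j then 1 else 0
  have hA : A ∈ Matrix.orthogonalGroup (Fin 3) ℝ := by
    rw [Matrix.mem_orthogonalGroup_iff]
    ext i j
    simp [A, Matrix.mul_apply, Matrix.one_apply, eq_comm]
  have h : ∀ i, e.coord i ∘ₗ Matrix.toLin e e A = e.coord (σ i) := by
    intro i
    simp [coord_comp_toLin, A]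
  simpa only [h] using invariant_symTensor hM hA (e.coord i) (e.coord j) (e.coord k) (e.coord l)

theorem invariant_symTensor_sign {M : Module.Dual ℝ (W V)} (hM : M ∈ orthogonalInvariants e)
    (s : Fin 3 → ℤ) (hs : ∀ i, s i * s i = 1) {i j k l : Fin 3}
    (h : s i * s j * s k * s l = -1) :
    M (symTensor (e.coord i) (e.coord j) (e.coord k) (e.coord l)) = 0 := by
  have hs' : ∀ i, (s i : ℝ) * s i = 1 := fun i => by exact_mod_cast hs i
  have h' : (s i * s j * s k * s l : ℝ) = -1 := by exact_mod_cast h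
  have hA : Matrix.diagonal (fun i => (s i : ℝ)) ∈ Matrix.orthogonalGroup (Fin 3) ℝ := by
    rw [Matrix.mem_orthogonalGroup_iff]
    simp [hs']
  have hc : ∀ i, e.coord i ∘ₗ Matrix.toLin e e (Matrix.diagonal fun i => (s i : ℝ))
      = (s i : ℝ) • e.coord i := by
    intro i
    simp [coord_comp_toLin, Matrix.diagonal_apply]
  have hm := invariant_symTensor hM hA (e.coord i) (e.coord j) (e.coord k) (e.coord l)
  rw [hc, hc, hc, hc, symTensor_smul, map_smul, h', smul_eq_mul] at hm
  linarith

theorem invariant_symTensor_self {M : Module.Dual ℝ (W V)} (hM : M ∈ orthogonalInvariants e) :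
    M (symTensor (e.coord 0) (e.coord 0) (e.coord 0) (e.coord 0))
      = 2 * M (symTensor (e.coord 0) (e.coord 0) (e.coord 1) (e.coord 1))
        + M (symTensor (e.coord 0) (e.coord 1) (e.coord 0) (e.coord 1)) := by
  let A : Matrix (Fin 3) (Fin 3) ℝ := !![3 / 5, 4 / 5, 0; -4 / 5, 3 / 5, 0; 0, 0, 1]
  have hA : A ∈ Matrix.orthogonalGroup (Fin 3) ℝ := by
    rw [Matrix.mem_orthogonalGroup_iff]
    ext i j
    fin_cases i <;> fin_cases j <;>
      simp [A, Matrix.mul_apply, Fin.sum_univ_succ] <;> norm_num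
  have hc : e.coord 0 ∘ₗ Matrix.toLin e e A
      = (3 / 5 : ℝ) • e.coord 0 + (4 / 5 : ℝ) • e.coord 1 := by
    simp [coord_comp_toLin, A, Fin.sum_univ_three]
  have hm := invariant_symTensor hM hA (e.coord 0) (e.coord 0) (e.coord 0) (e.coord 0)
  have h1 : M (symTensor (e.coord 1) (e.coord 1) (e.coord 1) (e.coord 1))
      = M (symTensor (e.coord 0) (e.coord 0) (e.coord 0) (e.coord 0)) := by
    simpa using invariant_symTensor_perm hM (Equiv.swap 0 1) 0 0 0 0
  have h2 : M (symTensor (e.coord 0) (e.coord 0) (e.coord 0) (e.coord 1)) = 0 :=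
    invariant_symTensor_sign hM ![-1, 1, 1] (by decide) (by decide)
  have h3 : M (symTensor (e.coord 0) (e.coord 1) (e.coord 1) (e.coord 1)) = 0 :=
    invariant_symTensor_sign hM ![-1, 1, 1] (by decide) (by decide)
  rw [hc, symTensor_self_add] at hm
  simp only [map_add, map_smul, smul_eq_mul, h1, h2, h3] at hm
  linarith

theorem invariant_symTensor_coord {M : Module.Dual ℝ (W V)} (hM : M ∈ orthogonalInvariants e)
    (i j k l : Fin 3) :
    M (symTensor (e.coord i) (e.coord j) (e.coord k) (e.coord l)) =
      M (symTensor (e.coord 0) (e.coord 0) (e.coord 1) (e.coord 1))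
        * ((if i = j ∧ k = l then 1 else 0) + if i = l ∧ j = k then 1 else 0)
      + M (symTensor (e.coord 0) (e.coord 1) (e.coord 0) (e.coord 1))
        * if i = k ∧ j = l then 1 else 0 := by
  have hσ : ∀ i k : Fin 3, i ≠ k → ∃ σ : Equiv.Perm (Fin 3), σ 0 = i ∧ σ 1 = k := by decide
  have hp : ∀ i k : Fin 3, i ≠ k →
      M (symTensor (e.coord i) (e.coord i) (e.coord k) (e.coord k))
        = M (symTensor (e.coord 0) (e.coord 0) (e.coord 1) (e.coord 1)) := by
    intro i k hik
    obtain ⟨σ, rfl, rfl⟩ := hσ i k hik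
    exact invariant_symTensor_perm hM σ 0 0 1 1
  have hq : ∀ i k : Fin 3, i ≠ k →
      M (symTensor (e.coord i) (e.coord k) (e.coord i) (e.coord k))
        = M (symTensor (e.coord 0) (e.coord 1) (e.coord 0) (e.coord 1)) := by
    intro i k hik
    obtain ⟨σ, rfl, rfl⟩ := hσ i k hik
    exact invariant_symTensor_perm hM σ 0 1 0 1
  have hr : ∀ i : Fin 3, M (symTensor (e.coord i) (e.coord i) (e.coord i) (e.coord i))
      = 2 * M (symTensor (e.coord 0) (e.coord 0) (e.coord 1) (e.coord 1))
        + M (symTensor (e.coord 0) (e.coord 1) (e.coord 0) (e.coord 1)) := by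
    intro i
    have h := invariant_symTensor_perm hM (Equiv.swap 0 i) 0 0 0 0
    rw [Equiv.swap_apply_left] at h
    rw [h, invariant_symTensor_self hM]
  have hcases : ∀ i j k l : Fin 3,
      (∃ t : Fin 3, (if i = t then -1 else 1 : ℤ) * (if j = t then -1 else 1)
          * (if k = t then -1 else 1) * (if l = t then -1 else 1) = -1
        ∧ ¬(i = j ∧ k = l) ∧ ¬(i = l ∧ j = k) ∧ ¬(i = k ∧ j = l))
      ∨ (i = j ∧ k = l) ∨ (i = l ∧ j = k) ∨ (i = k ∧ j = l) := by decide
  rcases hcases i j k l with ⟨t, ht, h1, h2, h3⟩ | ⟨rfl, rfl⟩ | ⟨rfl, rfl⟩ | ⟨rfl, rfl⟩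
  · rw [invariant_symTensor_sign hM (fun i => if i = t then -1 else 1)
      (fun i => by split_ifs <;> rfl) ht, if_neg h1, if_neg h2, if_neg h3]
    ring
  · by_cases hik : i = k
    · subst hik
      rw [hr]
      simp
      ring
    · rw [hp i k hik]
      simp [hik]
  · by_cases hij : i = j
    · subst hij
      rw [hr]
      simp
      ring
    · rw [symTensor_comm_even, hp i j hij]
      simp [hij]
  · by_cases hij : i = j
    · subst hij
      rw [hr]
      simp
      ring
    · rw [hq i j hij]
      simp [hij, Ne.symm hij]

theorem eq_invElement_of_mem_orthogonalInvariants {M : Module.Dual ℝ (W V)}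
    (hM : M ∈ orthogonalInvariants e) : ∃ a₁ a₂ : ℝ, M = invElement e a₁ a₂ := by
  obtain ⟨p, q, hM⟩ : ∃ p q : ℝ, ∀ i j k l : Fin 3,
      M (symTensor (e.coord i) (e.coord j) (e.coord k) (e.coord l)) =
        p * ((if i = j ∧ k = l then 1 else 0) + if i = l ∧ j = k then 1 else 0)
          + q * if i = k ∧ j = l then 1 else 0 := ⟨_, _, invariant_symTensor_coord hM⟩
  refine ⟨p, p + q, LinearMap.ext fun S => ?_⟩
  have h : ∀ i, ∑ j, (S : FourTensor V) (e i ⊗ₜ[ℝ] e j) (e j ⊗ₜ[ℝ] e i)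
      = ∑ j, (S : FourTensor V) (e i ⊗ₜ[ℝ] e i) (e j ⊗ₜ[ℝ] e j) := fun i =>
    Finset.sum_congr rfl fun j _ => W_tau S (e i) (e i) (e j) (e j)
  rw [invElement_apply]
  conv_lhs => rw [W_expand e S]
  simp only [map_sum, map_smul, smul_eq_mul, hM]
  simp only [ite_and, mul_add, mul_ite, mul_one, mul_zero, Finset.sum_add_distrib,
    Finset.sum_ite_irrel, Finset.sum_const_zero, Finset.sum_ite_eq, Finset.mem_univ, if_true, h,
    ← Finset.sum_mul]
  simp only [diagContraction, traceContraction]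
  ring

end Invariants

end FlavorCone

end

theorem mainTheorem4 {V : Type*} [AddCommGroup V] [Module ℝ V] (e : Module.Basis (Fin 3) ℝ V) :
    -- the coefficients `a₁, a₂` parametrize the invariant elements of `W*`
    (∀ a₁ a₂ : ℝ, FlavorCone.invElement e a₁ a₂ ∈ FlavorCone.orthogonalInvariants e) ∧
    (∀ M ∈ FlavorCone.orthogonalInvariants e,
      ∃! a : ℝ × ℝ, M = FlavorCone.invElement e a.1 a.2) ∧
    -- for invariant elements the elastic bounds describe the dual cone
    (∀ M ∈ FlavorCone.orthogonalInvariants e,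
      (M ∈ FlavorCone.dualCone V ↔ FlavorCone.ElasticBounds M)) ∧
    -- the elastic bounds reduce to `a₂ ≥ |a₁|`
    (∀ a₁ a₂ : ℝ, FlavorCone.ElasticBounds (FlavorCone.invElement e a₁ a₂) ↔ a₂ ≥ |a₁|) ∧
    -- the inelastic bounds follow from the elastic ones
    (∀ M ∈ FlavorCone.orthogonalInvariants e,
      FlavorCone.ElasticBounds M → FlavorCone.InelasticBounds M) ∧
    -- pions: the bounds `ℓ₂ ≥ -ℓ₁`, `ℓ₂ ≥ 0` are the elastic bounds, and they are optimal
    (∀ l₁ l₂ : ℝ, FlavorCone.pionElement e l₁ l₂ ∈ FlavorCone.orthogonalInvariants e ∧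
      (FlavorCone.ElasticBounds (FlavorCone.pionElement e l₁ l₂) ↔ l₂ ≥ -l₁ ∧ l₂ ≥ 0) ∧
      (FlavorCone.pionElement e l₁ l₂ ∈ FlavorCone.dualCone V ↔ l₂ ≥ -l₁ ∧ l₂ ≥ 0)) := by
  have hdual : ∀ a₁ a₂ : ℝ, FlavorCone.invElement e a₁ a₂ ∈ FlavorCone.dualCone V ↔
      FlavorCone.ElasticBounds (FlavorCone.invElement e a₁ a₂) := fun a₁ a₂ =>
    ⟨FlavorCone.elasticBounds_of_mem_dualCone, fun h =>
      FlavorCone.invElement_mem_dualCone e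
        ((FlavorCone.elasticBounds_invElement_iff e a₁ a₂).1 h)⟩
  have hpion : ∀ l₁ l₂ : ℝ, FlavorCone.ElasticBounds (FlavorCone.pionElement e l₁ l₂) ↔
      l₂ ≥ -l₁ ∧ l₂ ≥ 0 := by
    intro l₁ l₂
    rw [FlavorCone.pionElement_eq, FlavorCone.elasticBounds_invElement_iff, ge_iff_le, abs_le]
    constructor <;> rintro ⟨h1, h2⟩ <;> constructor <;> linarith
  refine ⟨FlavorCone.invElement_mem_orthogonalInvariants e, ?_, ?_,
    FlavorCone.elasticBounds_invElement_iff e, ?_, fun l₁ l₂ => ⟨?_, hpion l₁ l₂, ?_⟩⟩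
  · intro M hM
    obtain ⟨a₁, a₂, rfl⟩ := FlavorCone.eq_invElement_of_mem_orthogonalInvariants hM
    refine ⟨(a₁, a₂), rfl, fun b hb => ?_⟩
    obtain ⟨h1, h2⟩ := FlavorCone.invElement_injective e hb
    exact Prod.ext h1.symm h2.symm
  · intro M hM
    obtain ⟨a₁, a₂, rfl⟩ := FlavorCone.eq_invElement_of_mem_orthogonalInvariants hM
    exact hdual a₁ a₂
  · intro M hM hel
    obtain ⟨a₁, a₂, rfl⟩ := FlavorCone.eq_invElement_of_mem_orthogonalInvariants hM
    exact FlavorCone.inelasticBounds_of_mem_dualCone ((hdual a₁ a₂).2 hel)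
  · rw [FlavorCone.pionElement_eq]
    exact FlavorCone.invElement_mem_orthogonalInvariants e _ _
  · rw [← hpion, FlavorCone.pionElement_eq]
    exact hdual _ _
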